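/- Words are finite binary words, $\varepsilon$ is the empty word, $|w|$ is the length of $w$, and $|\vec x| = (|x_1|,\dots,|x_k|)$. For $k,l\in\mathbb N$ let $\mathcal B_{\mathsf{wsc}}^{k,l}$ be the set of functions $f(x_1,\dots,x_k;y_1,\dots,y_l)$ on words with $k$ normal and $l$ safe arguments that belong to the smallest class $\mathcal B_{\mathsf{wsc}}$ that contains the initial functions - $O^{k,l}(\vec x;\vec y)=\varepsilon$, and the projections to each normal and to each safe argument, - the successors $S_i(;y)=yi$ for $i\in\{0,1\}$, - the predecessor $P(;\varepsilon)=\varepsilon$, $P(;yi)=y$, - the conditional $C(;\varepsilon,y,z_0,z_1)=y$, $C(;xi,y,z_0,z_1)=z_i$, and is closed under - weak safe composition: $f(\vec x;\vec y)=h(x_{i_1},\dots,x_{i_n};g_1(\vec x;\vec y),\dots,g_m(\vec x;\vec y))$ with $n,m\ge 0$ and $i_1,\dots,i_n\in\{1,\dots,k\}$, - safe recursion on notation: $f(\varepsilon,\vec x;\vec y)=g(\vec x;\vec y)$ and $f(zi,\vec x;\vec y)=h_i(z,\vec x;\vec y,f(z,\vec x;\vec y))$ for $i\in\{0,1\}$.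 **Recursion simulation lemma.** Let $k,l\in\mathbb N$ and let $f$ be an $l$-ary function on binary words that is computable by a Turing machine in time polynomial in the length of its input. Then for every $k$-ary polynomial $p:\mathbb N^k\to\mathbb N$ with non-negative integer coefficients there exists a function $\{f,p\}\in\mathcal B_{\mathsf{wsc}}^{k,l}$ such that for all words $x_1,\dots,x_k$ and $b_1,\dots,b_l$ $$\max_{1\le j\le l}|b_j|\le p(|x_1|,\dots,|x_k|)\quad\Longrightarrow\quad \{f,p\}(\vec x;\vec b)=f(\vec b),$$ where the maximum over the empty set is $0$. -/

import Mathlib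

/-- Binary words. A word is stored with its **last** letter at the head of the list, so that
`[]` is the empty word `ε` and `i :: w` is the word `w i` (`false` is `0`, `true` is `1`). -/
abbrev BWord : Type := List Bool

namespace BWord

/-- The predecessor: `P(; ε) = ε` and `P(; w i) = w`. -/
def pred : BWord → BWord
  | [] => []
  | _ :: w => w

/-- The conditional: `C(; ε, y, z₀, z₁) = y` and `C(; w i, y, z₀, z₁) = zᵢ`. -/
def cond : BWord → BWord → BWord → BWord → BWord
  | [], y, _, _ => y
  | false :: _, _, z₀, _ => z₀
  | true :: _, _, _, z₁ => z₁

/-- The function given by safe recursion on notation from `g`, `h false = h₀`, `h true = h₁`: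
`f(ε, x; y) = g(x; y)` and `f(z i, x; y) = hᵢ(z, x; y, f(z, x; y))`. -/
def safeRec {k l : ℕ} (g : (Fin k → BWord) → (Fin l → BWord) → BWord)
    (h : Bool → (Fin (k + 1) → BWord) → (Fin (l + 1) → BWord) → BWord) :
    BWord → (Fin k → BWord) → (Fin l → BWord) → BWord
  | [], x, y => g x y
  | i :: z, x, y => h i (Fin.cons z x) (Fin.snoc y (safeRec g h z x y))

/-- A tuple of words as one string over the alphabet `{0, 1, #}` (`#` is `none`): every component
is written down and followed by the end marker `#`. -/
def encodeTuple {l : ℕ} (b : Fin l → BWord) : List (Option Bool) :=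
  (List.ofFn b).flatMap fun w => w.map some ++ [none]

/-- The tuple can be read off from its encoding. -/
theorem encodeTuple_injective (l : ℕ) :
    Function.Injective (encodeTuple : (Fin l → BWord) → List (Option Bool)) := by
  have key : ∀ (v w : BWord) (s t : List (Option Bool)),
      v.map some ++ none :: s = w.map some ++ none :: t → v = w ∧ s = t := by
    intro v
    induction v with
    | nil => intro w s t h; cases w <;> simp_all
    | cons a v ih =>
      intro w s t h
      cases w with
      | nil => simp at h
      | cons c w =>
        simp only [List.map_cons, List.cons_append, List.cons.injEq, Option.some.injEq] at h
        obtain ⟨h1, h2⟩ := ih w s t h.2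
        exact ⟨by rw [h.1, h1], h2⟩
  induction l with
  | zero => intro b c _; exact Subsingleton.elim b c
  | succ l ih =>
    intro b c h
    simp only [encodeTuple, List.ofFn_succ, List.flatMap_cons, List.append_assoc,
      List.singleton_append] at h
    obtain ⟨h0, h1⟩ := key _ _ _ _ h
    have h2 := ih (a₁ := fun i => b i.succ) (a₂ := fun i => c i.succ) h1
    funext i
    refine Fin.cases h0 (fun j => congrFun h2 j) i

/-- `f` is a polynomial-time function of `l` binary words: some Turing machine (with finitely many
stacks) computes `f`, in a number of steps bounded by a polynomial in the length of its input. -/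
def PolyTime {l : ℕ} (f : (Fin l → BWord) → BWord) : Prop :=
  Nonempty (Turing.TM2ComputableInPolyTime (encodeTuple : (Fin l → BWord) → List (Option Bool))
    (id : BWord → List Bool) f)

/-- `Bwsc k l F` says that `F(x₁, …, x_k; y₁, …, y_l)` belongs to `𝓑_wsc^{k,l}`, the functions of
`k` normal and `l` safe arguments in the smallest class that contains the initial functions and is
closed under weak safe composition and safe recursion on notation. -/
inductive Bwsc : (k l : ℕ) → ((Fin k → BWord) → (Fin l → BWord) → BWord) → Prop
  /-- `O^{k,l}(x; y) = ε` -/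
  | zero (k l : ℕ) : Bwsc k l fun _ _ => []
  /-- the projections to the normal arguments -/
  | projNormal (k l : ℕ) (j : Fin k) : Bwsc k l fun x _ => x j
  /-- the projections to the safe arguments -/
  | projSafe (k l : ℕ) (j : Fin l) : Bwsc k l fun _ y => y j
  /-- the successors `Sᵢ(; y) = y i` -/
  | succ (i : Bool) : Bwsc 0 1 fun _ y => i :: y 0
  /-- the predecessor -/
  | pred : Bwsc 0 1 fun _ y => BWord.pred (y 0)
  /-- the conditional -/
  | cond : Bwsc 0 4 fun _ y => BWord.cond (y 0) (y 1) (y 2) (y 3)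
  /-- weak safe composition `f(x; y) = h(x_{i₁}, …, x_{iₙ}; g₁(x; y), …, gₘ(x; y))`: only normal
  variables are substituted for the normal arguments of `h` -/
  | comp {k l n m : ℕ} {h : (Fin n → BWord) → (Fin m → BWord) → BWord}
      {g : Fin m → (Fin k → BWord) → (Fin l → BWord) → BWord} (i : Fin n → Fin k) :
      Bwsc n m h → (∀ j, Bwsc k l (g j)) →
      Bwsc k l fun x y => h (fun j => x (i j)) fun j => g j x y
  /-- safe recursion on notation, on the first normal argument -/
  | srn {k l : ℕ} {g : (Fin k → BWord) → (Fin l → BWord) → BWord}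
      {h : Bool → (Fin (k + 1) → BWord) → (Fin (l + 1) → BWord) → BWord} :
      Bwsc k l g → (∀ i, Bwsc (k + 1) (l + 1) (h i)) →
      Bwsc (k + 1) l fun x y => safeRec g h (x 0) (Fin.tail x) y

end BWord

/-!
Safe recursion defines one word at a time and gives no access to the inside of a safe word, so the
point is to keep a whole configuration of a machine in one safe word and to update it.

* A unary safe operation `H` can be iterated `q(|x|)` times for every polynomial `q`
  (`Bwsc.iterate`): a sum of polynomials becomes a composition, and a factor `X i` a recursion on
  the normal argument `x i`. In particular `q(|x|)` letters can be removed from a safe word.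
* In the same way, by induction on `q`, the top `q(|x|)` letters of a safe word can be moved one
  after the other onto another one (`Bwsc.revMapAppend`). Doing this twice concatenates safe words
  of polynomially bounded length, so that a tuple of such words can be packed into fields of fixed
  width in one word, and unpacked again. This gives simultaneous iteration of a tuple of safe
  operations (`exists_bwsc_iterate`).
* A stack machine is turned into such a tuple (`cfgWords`): for every symbol, the word that marks
  its positions on its stack, and for every control state a one-letter word. With these words, a
  step of the machine needs only predecessors, successors and conditionals
  (`exists_safeOp_totalStep`).

If the words `b j` are at most `p(|x|)` long, then the running time and the lengths of the stacks
are bounded by polynomials in `|x|`. So the words of the initial configuration are computed from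
`b`, the step is iterated as often as the time bound says, where halted configurations do not
change, and the result is the word that marks the letter `true` on the output stack.
-/

namespace BWord

/-! ### Closure properties of the class -/

theorem Bwsc.congr {k l : ℕ} {F G : (Fin k → BWord) → (Fin l → BWord) → BWord}
    (hF : Bwsc k l F) (h : ∀ x y, F x y = G x y) : Bwsc k l G := by
  have : F = G := by funext x y; exact h x y
  exact this ▸ hF

theorem Bwsc.subst {k l m : ℕ} {h : (Fin k → BWord) → (Fin m → BWord) → BWord}
    {g : Fin m → (Fin k → BWord) → (Fin l → BWord) → BWord}
    (hh : Bwsc k m h) (hg : ∀ j, Bwsc k l (g j)) :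
    Bwsc k l fun x y => h x fun j => g j x y :=
  Bwsc.comp id hh hg

theorem Bwsc.subst₁ {k l : ℕ} {h : (Fin k → BWord) → BWord → BWord}
    {g : (Fin k → BWord) → (Fin l → BWord) → BWord}
    (hh : Bwsc k 1 fun x y => h x (y 0)) (hg : Bwsc k l g) :
    Bwsc k l fun x y => h x (g x y) :=
  hh.subst fun _ => hg

theorem Bwsc.subst₂ {k l : ℕ} {h : (Fin k → BWord) → BWord → BWord → BWord}
    {g₀ g₁ : (Fin k → BWord) → (Fin l → BWord) → BWord}
    (hh : Bwsc k 2 fun x y => h x (y 0) (y 1)) (h₀ : Bwsc k l g₀) (h₁ : Bwsc k l g₁) :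
    Bwsc k l fun x y => h x (g₀ x y) (g₁ x y) :=
  hh.subst (g := ![g₀, g₁]) (by simp [Fin.forall_fin_two, h₀, h₁])

theorem Bwsc.cons {k l : ℕ} {g : (Fin k → BWord) → (Fin l → BWord) → BWord} (i : Bool)
    (hg : Bwsc k l g) : Bwsc k l fun x y => i :: g x y :=
  Bwsc.comp Fin.elim0 (Bwsc.succ i) fun _ => hg

theorem Bwsc.tail {k l : ℕ} {g : (Fin k → BWord) → (Fin l → BWord) → BWord}
    (hg : Bwsc k l g) : Bwsc k l fun x y => (g x y).tail :=
  (Bwsc.comp Fin.elim0 Bwsc.pred fun _ => hg).congr fun x y => by cases g x y <;> rfl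

theorem Bwsc.cond' {k l : ℕ} {a b c d : (Fin k → BWord) → (Fin l → BWord) → BWord}
    (ha : Bwsc k l a) (hb : Bwsc k l b) (hc : Bwsc k l c) (hd : Bwsc k l d) :
    Bwsc k l fun x y => BWord.cond (a x y) (b x y) (c x y) (d x y) :=
  Bwsc.comp (g := ![a, b, c, d]) Fin.elim0 Bwsc.cond
    (by simp [Fin.forall_fin_succ, ha, hb, hc, hd])

/-- Bounded recursion along a normal variable `x i`, where the step function knows the number of
steps already made. -/
theorem Bwsc.natRec {k l : ℕ} {g : (Fin k → BWord) → (Fin l → BWord) → BWord}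
    {ψ : ℕ → (Fin k → BWord) → (Fin l → BWord) → BWord → BWord} (hg : Bwsc k l g)
    (hψ : Bwsc (k + 1) (l + 1) fun x y =>
      ψ (x 0).length (Fin.tail x) (Fin.init y) (y (Fin.last l)))
    (i : Fin k) :
    Bwsc k l fun x y => Nat.rec (g x y) (fun n r => ψ n x y r) (x i).length := by
  refine (Bwsc.comp (Fin.cons i id : Fin (k + 1) → Fin k) (Bwsc.srn hg fun _ => hψ)
    fun j => Bwsc.projSafe k l j).congr fun x y => ?_
  have hx : (Fin.tail fun j => x ((Fin.cons i id : Fin (k + 1) → Fin k) j)) = x := by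
    funext j; simp [Fin.tail]
  rw [hx]
  simp only [Fin.cons_zero]
  induction x i with
  | nil => rfl
  | cons a z ih => simp [safeRec, ih, Fin.tail_cons]

/-! ### Iteration of polynomial length -/

/-- The value of the polynomial `q` at the lengths of the words `x`. -/
noncomputable def polyLen {k : ℕ} (q : MvPolynomial (Fin k) ℕ) (x : Fin k → BWord) : ℕ :=
  MvPolynomial.eval (fun i => (x i).length) q

/-- Iterating a unary safe operation a polynomial number of times stays in the class: sums of
polynomials are handled by composition, and the factor `X i` by a recursion on `x i`. -/
theorem Bwsc.iterate {k : ℕ} {H : (Fin k → BWord) → BWord → BWord}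
    (hH : Bwsc k 1 fun x y => H x (y 0)) (q : MvPolynomial (Fin k) ℕ) :
    Bwsc k 1 fun x y => (H x)^[polyLen q x] (y 0) := by
  induction q using MvPolynomial.induction_on with
  | C a =>
    simp only [polyLen, MvPolynomial.eval_C]
    induction a with
    | zero => exact Bwsc.projSafe k 1 0
    | succ a ih => simpa only [Function.iterate_succ_apply'] using hH.subst₁ ih
  | add q₁ q₂ h₁ h₂ =>
    simpa only [polyLen, map_add, Function.iterate_add_apply] using h₁.subst₁ h₂
  | mul_X q i ih =>
    refine (Bwsc.natRec (ψ := fun _ x _ r => (H x)^[polyLen q x] r) (Bwsc.projSafe k 1 0)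
      (Bwsc.comp Fin.succ ih fun _ => Bwsc.projSafe _ _ (Fin.last 1)) i).congr fun x y => ?_
    have : polyLen (q * MvPolynomial.X i) x = polyLen q x * (x i).length := by simp [polyLen]
    rw [this, Function.iterate_mul]
    induction (x i).length with
    | zero => rfl
    | succ n ih => rw [Function.iterate_succ_apply', ← ih]

theorem Bwsc.drop {k l : ℕ} {v : (Fin k → BWord) → (Fin l → BWord) → BWord} (hv : Bwsc k l v)
    (q : MvPolynomial (Fin k) ℕ) : Bwsc k l fun x y => (v x y).drop (polyLen q x) := by
  have h : ∀ (n : ℕ) (w : BWord), List.tail^[n] w = w.drop n := by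
    intro n
    induction n with
    | zero => simp
    | succ n ih => intro w; rw [Function.iterate_succ_apply', ih, List.tail_drop]
  refine (((Bwsc.projSafe k 1 0).tail.iterate (H := fun _ => List.tail) q).subst₁ hv).congr
    fun x y => h _ _

theorem Bwsc.replicate {k l : ℕ} {v : (Fin k → BWord) → (Fin l → BWord) → BWord}
    (hv : Bwsc k l v) (q : MvPolynomial (Fin k) ℕ) (b : Bool) :
    Bwsc k l fun x y => List.replicate (polyLen q x) b ++ v x y := by
  have h : ∀ (n : ℕ) (w : BWord), (List.cons b)^[n] w = List.replicate n b ++ w := by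
    intro n w
    induction n with
    | zero => simp
    | succ n ih => rw [Function.iterate_succ_apply', ih, List.replicate_succ, List.cons_append]
  exact ((((Bwsc.projSafe k 1 0).cons b).iterate (H := fun _ => List.cons b) q).subst₁ hv).congr
    fun x y => h _ _

/-! ### Reversal and concatenation of words of polynomial length -/

/-- Move the top `n` letters of `v` one after the other onto `r`, applying `χ` to each letter. -/
def revMapAppend (χ : Bool → Bool) (n : ℕ) (v r : BWord) : BWord :=
  ((v.take n).map χ).reverse ++ r

theorem revMapAppend_add (χ : Bool → Bool) (m n : ℕ) (v r : BWord) :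
    revMapAppend χ (m + n) v r = revMapAppend χ n (v.drop m) (revMapAppend χ m v r) := by
  simp [revMapAppend, List.take_add]

/-- The step function of the recursion for `q * X i` has to read `v` at a depth that grows with
the number of steps made, so it uses the recursion variable. -/
theorem Bwsc.revMapAppend_aux {k : ℕ} (χ : Bool → Bool) (q : MvPolynomial (Fin k) ℕ) :
    Bwsc k 2 fun x y => revMapAppend χ (polyLen q x) (y 0) (y 1) := by
  induction q using MvPolynomial.induction_on with
  | C a =>
    simp only [polyLen, MvPolynomial.eval_C]
    induction a with
    | zero => simpa [revMapAppend] using Bwsc.projSafe k 2 1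
    | succ a ih =>
      refine (Bwsc.cond' ((Bwsc.projSafe k 2 0).drop (MvPolynomial.C a)) ih (ih.cons (χ false))
        (ih.cons (χ true))).congr fun x y => ?_
      rw [revMapAppend_add]
      simp only [polyLen, MvPolynomial.eval_C]
      rcases (y 0).drop a with _ | ⟨_ | _, w⟩ <;> simp [BWord.cond, revMapAppend]
  | add q₁ q₂ h₁ h₂ =>
    refine (h₂.subst₂ ((Bwsc.projSafe k 2 0).drop q₁) h₁).congr fun x y => ?_
    simp only [polyLen, map_add, revMapAppend_add]
  | mul_X q i ih =>
    refine (Bwsc.natRec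
      (ψ := fun n x y r => revMapAppend χ (polyLen q x) ((y 0).drop (polyLen q x * n)) r)
      (Bwsc.projSafe k 2 1) ?_ i).congr fun x y => ?_
    · refine ((Bwsc.comp (k := k + 1) (l := 2) Fin.succ ih (Bwsc.projSafe _ _)).subst₂
        ((Bwsc.projSafe (k + 1) 3 0).drop (MvPolynomial.rename Fin.succ q * MvPolynomial.X 0))
        (Bwsc.projSafe _ _ (Fin.last 2))).congr fun x y => ?_
      have : polyLen (MvPolynomial.rename Fin.succ q * MvPolynomial.X 0) x
          = polyLen q (Fin.tail x) * (x 0).length := by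
        simp only [polyLen, map_mul, MvPolynomial.eval_rename, MvPolynomial.eval_X]
        rfl
      rw [this]
      rfl
    · have : polyLen (q * MvPolynomial.X i) x = polyLen q x * (x i).length := by simp [polyLen]
      rw [this]
      induction (x i).length with
      | zero => simp [revMapAppend]
      | succ n ih => rw [Nat.mul_succ, revMapAppend_add, ← ih]

theorem Bwsc.revMapAppend {k l : ℕ} {v r : (Fin k → BWord) → (Fin l → BWord) → BWord}
    (χ : Bool → Bool) (q : MvPolynomial (Fin k) ℕ) (hv : Bwsc k l v) (hr : Bwsc k l r) :
    Bwsc k l fun x y => BWord.revMapAppend χ (polyLen q x) (v x y) (r x y) :=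
  (Bwsc.revMapAppend_aux χ q).subst₂ hv hr

theorem Bwsc.takeMapAppend {k l : ℕ} {v r : (Fin k → BWord) → (Fin l → BWord) → BWord}
    (χ : Bool → Bool) (q : MvPolynomial (Fin k) ℕ) (hv : Bwsc k l v) (hr : Bwsc k l r) :
    Bwsc k l fun x y => ((v x y).take (polyLen q x)).map χ ++ r x y := by
  refine (Bwsc.revMapAppend id q (Bwsc.revMapAppend χ q hv (Bwsc.zero k l)) hr).congr
    fun x y => ?_
  simp only [BWord.revMapAppend, List.append_nil, List.map_id]
  rw [List.take_of_length_le (by simp), List.reverse_reverse]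

/-! ### Tuples of words of polynomial length in one word -/

/-- A word of length at most `n` in a field of fixed width `n + 1`: the word, a marker `true`,
and a padding with `false`. -/
def field (n : ℕ) (u : BWord) : BWord :=
  (u.take n ++ true :: List.replicate n false).take (n + 1)

/-- The word at the head of `w` in the format of `field`: reverse the field, remove the padding and
the marker, and reverse again. -/
def unfield (n : ℕ) (w : BWord) : BWord :=
  revMapAppend id (n + 1)
    ((fun r => BWord.cond r [] r.tail r)^[n] (revMapAppend id (n + 1) w [])).tail []

theorem field_eq {n : ℕ} {u : BWord} (hu : u.length ≤ n) :
    field n u = u ++ true :: List.replicate (n - u.length) false := by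
  rw [field, List.take_of_length_le hu, List.take_append, List.take_of_length_le (by omega),
    show n + 1 - u.length = (n - u.length) + 1 by omega, List.take_succ_cons, List.take_replicate,
    min_eq_left (by omega)]

theorem length_field (n : ℕ) (u : BWord) : (field n u).length = n + 1 := by
  simp [field]

theorem unfield_field_append {n : ℕ} {u : BWord} (hu : u.length ≤ n) (w : BWord) :
    unfield n (field n u ++ w) = u := by
  have h₁ : ∀ (a : ℕ) (s : BWord),
      (fun r => BWord.cond r [] r.tail r)^[a] (List.replicate a false ++ s) = s := by
    intro a s
    induction a with
    | zero => rfl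
    | succ a ih => rw [Function.iterate_succ_apply]; exact ih
  have h₂ : ∀ (b : ℕ) (s : BWord),
      (fun r => BWord.cond r [] r.tail r)^[b] (true :: s) = true :: s :=
    fun b s => Function.iterate_fixed rfl b
  have h₃ : revMapAppend id (n + 1) (field n u ++ w) []
      = List.replicate (n - u.length) false ++ true :: u.reverse := by
    rw [revMapAppend, List.take_left' (length_field n u), field_eq hu]
    simp
  rw [unfield, h₃]
  nth_rw 2 [← Nat.add_sub_cancel' hu]
  rw [Function.iterate_add_apply, h₁, h₂, List.tail_cons, revMapAppend,
    List.take_of_length_le (by simp; omega)]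
  simp

theorem Bwsc.unfield {k l : ℕ} {v : (Fin k → BWord) → (Fin l → BWord) → BWord} (hv : Bwsc k l v)
    (q : MvPolynomial (Fin k) ℕ) : Bwsc k l fun x y => BWord.unfield (polyLen q x) (v x y) := by
  have h₁ : Bwsc k 1 fun _ y => BWord.cond (y 0) [] (y 0).tail (y 0) :=
    Bwsc.cond' (Bwsc.projSafe k 1 0) (Bwsc.zero k 1) (Bwsc.projSafe k 1 0).tail
      (Bwsc.projSafe k 1 0)
  refine ((((h₁.iterate (H := fun _ r => BWord.cond r [] r.tail r) q).subst₁
    (hv.revMapAppend id (q + 1) (Bwsc.zero k l))).tail).revMapAppend id (q + 1)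
      (Bwsc.zero k l)).congr fun x y => ?_
  simp [BWord.unfield, polyLen]

theorem Bwsc.field_append {k l : ℕ} {v w : (Fin k → BWord) → (Fin l → BWord) → BWord}
    (hv : Bwsc k l v) (hw : Bwsc k l w) (q : MvPolynomial (Fin k) ℕ) :
    Bwsc k l fun x y => BWord.field (polyLen q x) (v x y) ++ w x y := by
  refine ((hv.takeMapAppend id q (((Bwsc.zero k l).replicate q false).cons true)).takeMapAppend id
    (q + 1) hw).congr fun x y => ?_
  simp [BWord.field, polyLen]

/-- The concatenation of the fields of the words `u j`. -/
def pack (n : ℕ) : {m : ℕ} → (Fin m → BWord) → BWord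
  | 0, _ => []
  | _ + 1, u => field n (u 0) ++ pack n (Fin.tail u)

theorem unfield_drop_pack {n m : ℕ} {u : Fin m → BWord} (hu : ∀ j, (u j).length ≤ n) (j : Fin m) :
    unfield n ((pack n u).drop ((n + 1) * j)) = u j := by
  induction m with
  | zero => exact j.elim0
  | succ m ih =>
    refine Fin.cases ?_ (fun j => ?_) j
    · simp only [Fin.val_zero, mul_zero, List.drop_zero, pack]
      exact unfield_field_append (hu 0) _
    · rw [show u j.succ = Fin.tail u j from rfl,
        ← ih (u := Fin.tail u) (fun i => hu i.succ) j, pack, Fin.val_succ, mul_add, mul_one,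
        add_comm, ← List.drop_drop, List.drop_left' (length_field n _)]

theorem Bwsc.pack {k l m : ℕ} {g : Fin m → (Fin k → BWord) → (Fin l → BWord) → BWord}
    (hg : ∀ j, Bwsc k l (g j)) (q : MvPolynomial (Fin k) ℕ) :
    Bwsc k l fun x y => BWord.pack (polyLen q x) fun j => g j x y := by
  induction m with
  | zero => exact Bwsc.zero k l
  | succ m ih => exact (hg 0).field_append (ih fun j => hg j.succ) q

/-! ### Simultaneous iteration -/

/-- An operation on families of words that can be substituted in the safe arguments of the class:
applied to a family of functions of the class it gives a function of the class. -/
def SafeOp {J : Type} (φ : (J → BWord) → BWord) : Prop :=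
  ∀ ⦃k l : ℕ⦄ (g : J → (Fin k → BWord) → (Fin l → BWord) → BWord),
    (∀ j, Bwsc k l (g j)) → Bwsc k l fun x y => φ fun j => g j x y

theorem SafeOp.proj {J : Type} (j : J) : SafeOp fun y : J → BWord => y j :=
  fun _ _ _ hg => hg j

theorem SafeOp.nil {J : Type} : SafeOp fun _ : J → BWord => [] :=
  fun k l _ _ => Bwsc.zero k l

theorem SafeOp.cons {J : Type} {φ : (J → BWord) → BWord} (b : Bool) (hφ : SafeOp φ) :
    SafeOp fun y => b :: φ y :=
  fun _ _ g hg => (hφ g hg).cons b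

theorem SafeOp.tail {J : Type} {φ : (J → BWord) → BWord} (hφ : SafeOp φ) :
    SafeOp fun y => (φ y).tail :=
  fun _ _ g hg => (hφ g hg).tail

theorem SafeOp.comp {J I : Type} {φ : (I → BWord) → BWord} {ψ : (J → BWord) → I → BWord}
    (hφ : SafeOp φ) (hψ : ∀ i, SafeOp fun y => ψ y i) : SafeOp fun y => φ (ψ y) :=
  fun _ _ g hg => hφ (fun i x y => ψ (fun j => g j x y) i) fun i => hψ i g hg

theorem SafeOp.ite_head {J : Type} {φ ψ χ : (J → BWord) → BWord} (hφ : SafeOp φ)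
    (hψ : SafeOp ψ) (hχ : SafeOp χ) :
    SafeOp fun y => if (φ y).head? = some true then ψ y else χ y := by
  have h : ∀ w b c : BWord, BWord.cond w c c b = if w.head? = some true then b else c := by
    rintro (_ | ⟨_ | _, w⟩) b c <;> simp [BWord.cond]
  intro k l g hg
  exact (Bwsc.cond' (hφ g hg) (hχ g hg) (hχ g hg) (hψ g hg)).congr fun x y => h _ _ _

/-- Iterating a safe operation on families of words a polynomial number of times stays in the
class, as far as the lengths of the words remain polynomially bounded: the whole family is kept in
one safe word. -/
theorem exists_bwsc_iterate {J : Type} [Finite J] {k l : ℕ} {T : (J → BWord) → J → BWord}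
    (hT : ∀ j, SafeOp fun y => T y j) (q t : MvPolynomial (Fin k) ℕ)
    {g : J → (Fin k → BWord) → (Fin l → BWord) → BWord} (hg : ∀ j, Bwsc k l (g j)) (j : J) :
    ∃ G, Bwsc k l G ∧ ∀ x y,
      (∀ i ≤ polyLen t x, ∀ j, (T^[i] (fun j => g j x y) j).length ≤ polyLen q x) →
        G x y = T^[polyLen t x] (fun j => g j x y) j := by
  obtain ⟨m, ⟨e⟩⟩ := Finite.exists_equiv_fin J
  let enc : (Fin k → BWord) → (J → BWord) → BWord := fun x u =>
    BWord.pack (polyLen q x) fun i => u (e.symm i)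
  let dec : (Fin k → BWord) → BWord → J → BWord := fun x w j =>
    BWord.unfield (polyLen q x) (w.drop ((polyLen q x + 1) * e j))
  have hdec : ∀ (l' : ℕ) (v : (Fin k → BWord) → (Fin l' → BWord) → BWord), Bwsc k l' v →
      ∀ j, Bwsc k l' fun x y => dec x (v x y) j := by
    intro l' v hv j
    refine ((hv.drop ((q + 1) * MvPolynomial.C (e j : ℕ))).unfield q).congr fun x y => ?_
    simp [dec, polyLen]
  have henc : ∀ (l' : ℕ) (u : J → (Fin k → BWord) → (Fin l' → BWord) → BWord),
      (∀ j, Bwsc k l' (u j)) → Bwsc k l' fun x y => enc x fun j => u j x y :=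
    fun l' u hu => Bwsc.pack (fun i => hu (e.symm i)) q
  have hde : ∀ x u, (∀ j, (u j).length ≤ polyLen q x) → dec x (enc x u) = u := by
    intro x u hu
    funext j
    have := unfield_drop_pack (u := fun i => u (e.symm i)) (fun i => hu _) (e j)
    simpa [dec, enc] using this
  have hstep : Bwsc k 1 fun x y => enc x (T (dec x (y 0))) :=
    henc 1 (fun j x y => T (dec x (y 0)) j)
      fun j => hT j _ (hdec 1 _ (Bwsc.projSafe k 1 0))
  refine ⟨_, hdec l _ ((hstep.iterate (H := fun x w => enc x (T (dec x w))) t).subst₁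
    (henc l g hg)) j, fun x y hb => ?_⟩
  have key : ∀ i ≤ polyLen t x, (fun w => enc x (T (dec x w)))^[i] (enc x fun j => g j x y)
      = enc x (T^[i] fun j => g j x y) := by
    intro i hi
    induction i with
    | zero => rfl
    | succ i ih =>
      rw [Function.iterate_succ_apply', ih (by omega), Function.iterate_succ_apply',
        hde x _ (hb i (by omega))]
  rw [key _ le_rfl, hde x _ (hb _ le_rfl)]

end BWord

/-! ### Stack machines -/

open Turing in
/-- The symbols that a statement can push, each with the stack it is pushed on. -/
def Turing.TM2.Stmt.pushes {K Λ σ : Type} {Γ : K → Type} :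
    TM2.Stmt Γ Λ σ → Set (Σ k, Γ k)
  | push k f q => Set.range (fun v => ⟨k, f v⟩) ∪ q.pushes
  | peek _ _ q => q.pushes
  | pop _ _ q => q.pushes
  | load _ q => q.pushes
  | branch _ q₁ q₂ => q₁.pushes ∪ q₂.pushes
  | goto _ => ∅
  | halt => ∅

namespace BWord

open Turing

section TM2

variable {K Λ σ : Type} {Γ : K → Type}

theorem finite_pushes [Finite σ] (q : TM2.Stmt Γ Λ σ) : q.pushes.Finite := by
  induction q with
  | push k f q ih => exact (Set.finite_range _).union ih
  | peek _ _ q ih => exact ih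
  | pop _ _ q ih => exact ih
  | load _ q ih => exact ih
  | branch _ q₁ q₂ h₁ h₂ => exact h₁.union h₂
  | goto _ => exact Set.finite_empty
  | halt => exact Set.finite_empty

/-- All symbols on the stacks `S` belong to `A`. -/
def Over (A : Set (Σ k, Γ k)) (S : ∀ k, List (Γ k)) : Prop :=
  ∀ k, ∀ s ∈ S k, (⟨k, s⟩ : Σ k, Γ k) ∈ A

variable [DecidableEq K]

theorem Over.push {A : Set (Σ k, Γ k)} {S : ∀ k, List (Γ k)} (hS : Over A S) {k : K} {a : Γ k}
    (ha : ⟨k, a⟩ ∈ A) : Over A (Function.update S k (a :: S k)) := by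
  intro k' s hs
  obtain rfl | hk := eq_or_ne k' k
  · rw [Function.update_self, List.mem_cons] at hs
    exact hs.elim (fun h => h ▸ ha) (hS _ _)
  · rw [Function.update_of_ne hk] at hs
    exact hS _ _ hs

theorem Over.pop {A : Set (Σ k, Γ k)} {S : ∀ k, List (Γ k)} (hS : Over A S) (k : K) :
    Over A (Function.update S k (S k).tail) := by
  intro k' s hs
  obtain rfl | hk := eq_or_ne k' k
  · rw [Function.update_self] at hs
    exact hS _ _ (List.mem_of_mem_tail hs)
  · rw [Function.update_of_ne hk] at hs
    exact hS _ _ hs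

theorem Over.stepAux {A : Set (Σ k, Γ k)} (q : TM2.Stmt Γ Λ σ) (hq : q.pushes ⊆ A) (v : σ)
    {S : ∀ k, List (Γ k)} (hS : Over A S) : Over A (TM2.stepAux q v S).stk := by
  induction q generalizing v S with
  | push k f q ih =>
    exact ih (fun _ h => hq (Or.inr h)) v (hS.push (hq (Or.inl ⟨v, rfl⟩)))
  | peek k f q ih => exact ih hq _ hS
  | pop k f q ih => exact ih hq _ (hS.pop k)
  | load a q ih => exact ih hq _ hS
  | branch f q₁ q₂ h₁ h₂ =>
    rw [TM2.stepAux]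
    cases f v
    · exact h₂ (fun _ h => hq (Or.inr h)) v hS
    · exact h₁ (fun _ h => hq (Or.inl h)) v hS
  | goto _ => exact hS
  | halt => exact hS

theorem exists_length_stepAux_le (q : TM2.Stmt Γ Λ σ) :
    ∃ D, ∀ v S k, ((TM2.stepAux q v S).stk k).length ≤ (S k).length + D := by
  induction q with
  | push k f q ih =>
    obtain ⟨D, hD⟩ := ih
    refine ⟨D + 1, fun v S k' => (hD v _ k').trans ?_⟩
    obtain rfl | hk := eq_or_ne k' k
    · simp; omega
    · simp [hk]
  | peek k f q ih => exact ih.imp fun D hD v S k' => hD _ S k'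
  | pop k f q ih =>
    obtain ⟨D, hD⟩ := ih
    refine ⟨D, fun v S k' => (hD _ _ k').trans ?_⟩
    obtain rfl | hk := eq_or_ne k' k
    · simp
    · simp [hk]
  | load a q ih => exact ih.imp fun D hD v S k' => hD _ S k'
  | branch f q₁ q₂ h₁ h₂ =>
    obtain ⟨D₁, h₁⟩ := h₁
    obtain ⟨D₂, h₂⟩ := h₂
    refine ⟨D₁ + D₂, fun v S k' => ?_⟩
    rw [TM2.stepAux]
    cases f v
    · exact (h₂ v S k').trans (by omega)
    · exact (h₁ v S k').trans (by omega)
  | goto _ => exact ⟨0, fun _ _ _ => le_rfl⟩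
  | halt => exact ⟨0, fun _ _ _ => le_rfl⟩

/-- The step function of a machine, made total: a halted configuration stays as it is. -/
def totalStep (M : Λ → TM2.Stmt Γ Λ σ) (c : TM2.Cfg Γ Λ σ) : TM2.Cfg Γ Λ σ :=
  (TM2.step M c).getD c

theorem Over.totalStep {A : Set (Σ k, Γ k)} {M : Λ → TM2.Stmt Γ Λ σ}
    (hM : ∀ q, (M q).pushes ⊆ A) {c : TM2.Cfg Γ Λ σ} (hc : Over A c.stk) :
    Over A (totalStep M c).stk := by
  obtain ⟨_ | q, v, S⟩ := c
  · exact hc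
  · exact Over.stepAux (M q) (hM q) v hc

theorem exists_length_totalStep_le [Finite Λ] (M : Λ → TM2.Stmt Γ Λ σ) :
    ∃ D, ∀ c k, ((totalStep M c).stk k).length ≤ (c.stk k).length + D := by
  choose D hD using fun q => exists_length_stepAux_le (M q)
  obtain ⟨B, hB⟩ := (Set.finite_range D).bddAbove
  refine ⟨B, fun c k => ?_⟩
  obtain ⟨_ | q, v, S⟩ := c
  · exact Nat.le_add_right _ _
  · exact (hD q v S k).trans (Nat.add_le_add_left (hB ⟨q, rfl⟩) _)

/-! ### Configurations as families of words -/

open Classical in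
/-- The positions of the symbol `e.2` on the stack `e.1`, as a word. -/
noncomputable def track (S : ∀ k, List (Γ k)) (e : Σ k, Γ k) : BWord :=
  (S e.1).map fun s => decide (s = e.2)

open Classical in
/-- A configuration as a family of words: one word for each symbol of each stack, and a one-letter
word for each control state, which tells whether the machine is in this state. -/
noncomputable def cfgWords (A : Set (Σ k, Γ k)) (c : TM2.Cfg Γ Λ σ) :
    A ⊕ (Option Λ × σ) → BWord :=
  Sum.elim (fun e => track c.stk e) fun s => [decide ((c.l, c.var) = s)]

open Classical in
theorem track_push (S : ∀ k, List (Γ k)) (k : K) (a : Γ k) (e : Σ k, Γ k) :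
    track (Function.update S k (a :: S k)) e
      = if e.1 = k then decide (⟨k, a⟩ = e) :: track S e else track S e := by
  obtain ⟨k', b⟩ := e
  split_ifs with h
  · obtain rfl : k' = k := h
    simp [track]
  · simp [track, Function.update_of_ne h]

theorem track_pop (S : ∀ k, List (Γ k)) (k : K) (e : Σ k, Γ k) :
    track (Function.update S k (S k).tail) e
      = if e.1 = k then (track S e).tail else track S e := by
  obtain ⟨k', b⟩ := e
  split_ifs with h
  · obtain rfl : k' = k := h
    simp [track, List.map_tail]
  · simp [track, Function.update_of_ne h]

omit [DecidableEq K] in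
theorem head?_track {S : ∀ k, List (Γ k)} {k : K} {a : Γ k} :
    (track S ⟨k, a⟩).head? = some true ↔ (S k).head? = some a := by
  simp only [track]
  cases S k <;> simp

/-- Definition by cases on a family of words of which at most one has the top letter `true`. -/
theorem exists_safeOp_select {J I ι : Type} [Finite ι] (t : ι → J)
    {φ : ι → (J → BWord) → I → BWord} {d : (J → BWord) → I → BWord}
    (hφ : ∀ i j, SafeOp fun y => φ i y j) (hd : ∀ j, SafeOp fun y => d y j) :
    ∃ Ψ : (J → BWord) → I → BWord, (∀ j, SafeOp fun y => Ψ y j) ∧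
      (∀ y i, (∀ i', (y (t i')).head? = some true ↔ i' = i) → Ψ y = φ i y) ∧
      ∀ y, (∀ i, (y (t i)).head? ≠ some true) → Ψ y = d y := by
  have key : ∀ L : List ι, ∃ Ψ : (J → BWord) → I → BWord, (∀ j, SafeOp fun y => Ψ y j) ∧
      (∀ y, ∀ i ∈ L, (∀ i', (y (t i')).head? = some true ↔ i' = i) → Ψ y = φ i y) ∧
      ∀ y, (∀ i, (y (t i)).head? ≠ some true) → Ψ y = d y := by
    intro L
    induction L with
    | nil => exact ⟨d, hd, by simp, fun _ _ => rfl⟩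
    | cons i L ih =>
      obtain ⟨Ψ, h₀, h₁, h₂⟩ := ih
      refine ⟨fun y => if (y (t i)).head? = some true then φ i y else Ψ y, fun j => ?_,
        fun y i' hi' hy => ?_, fun y hy => ?_⟩
      · have := (SafeOp.proj (t i)).ite_head (hφ i j) (h₀ j)
        convert this using 2 with y
        by_cases h : (y (t i)).head? = some true <;> simp [h]
      · by_cases h : i = i'
        · subst h; simp [hy]
        · have hne : ¬ (y (t i)).head? = some true := fun h' => h ((hy i).1 h')
          simp only [hne, if_false]
          exact h₁ y i' ((List.mem_cons.1 hi').resolve_left fun h' => h h'.symm) hy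
      · simp only [hy i, if_false]
        exact h₂ y hy
  have := Fintype.ofFinite ι
  obtain ⟨Ψ, h₀, h₁, h₂⟩ := key Finset.univ.toList
  exact ⟨Ψ, h₀, fun y i => h₁ y i (by simp), h₂⟩

omit [DecidableEq K] in
/-- Definition by cases on the top symbol of a stack. -/
theorem exists_safeOp_head? {A : Set (Σ k, Γ k)} (hA : A.Finite) {I J : Type} (k : K)
    {φ : Option (Γ k) → (A ⊕ J → BWord) → I → BWord}
    (hφ : ∀ o j, SafeOp fun y => φ o y j) :
    ∃ Ψ : (A ⊕ J → BWord) → I → BWord, (∀ j, SafeOp fun y => Ψ y j) ∧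
      ∀ S, Over A S → ∀ y, (∀ e : A, y (Sum.inl e) = track S e) → Ψ y = φ (S k).head? y := by
  have : Finite {s : Γ k | (⟨k, s⟩ : Σ k, Γ k) ∈ A} :=
    hA.preimage (sigma_mk_injective.injOn)
  obtain ⟨Ψ, h₀, h₁, h₂⟩ := exists_safeOp_select (J := A ⊕ J)
    (ι := {s : Γ k | (⟨k, s⟩ : Σ k, Γ k) ∈ A})
    (fun s => Sum.inl ⟨⟨k, s.1⟩, s.2⟩) (φ := fun s => φ (some s.1)) (d := φ none)
    (fun s => hφ _) (hφ _)
  refine ⟨Ψ, h₀, fun S hS y hy => ?_⟩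
  cases h : (S k).head? with
  | none =>
    refine h₂ y fun s => ?_
    rw [hy, Ne, head?_track, h]
    simp
  | some a =>
    refine h₁ y ⟨a, hS k a (List.mem_of_mem_head? h)⟩ fun s => ?_
    rw [hy, head?_track, h, Option.some_inj, Subtype.ext_iff, eq_comm]

/-- The effect of a statement is a safe operation on the words of a configuration. The value `v` of
the internal variable is fixed here: as there are finitely many values, the operation can
differ from one to the next. -/
theorem exists_safeOp_stepAux {A : Set (Σ k, Γ k)} (hA : A.Finite) (q : TM2.Stmt Γ Λ σ)
    (hq : q.pushes ⊆ A) (v : σ) :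
    ∃ Φ : (A ⊕ (Option Λ × σ) → BWord) → A ⊕ (Option Λ × σ) → BWord,
      (∀ j, SafeOp fun y => Φ y j) ∧ ∀ S, Over A S → ∀ y,
        (∀ e : A, y (Sum.inl e) = track S e) → Φ y = cfgWords A (TM2.stepAux q v S) := by
  classical
  have hgoto : ∀ (l : Option Λ) (v : σ),
      ∃ Φ : (A ⊕ (Option Λ × σ) → BWord) → A ⊕ (Option Λ × σ) → BWord,
      (∀ j, SafeOp fun y => Φ y j) ∧ ∀ S, Over A S → ∀ y,
        (∀ e : A, y (Sum.inl e) = track S e) → Φ y = cfgWords A ⟨l, v, S⟩ := by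
    intro l v
    refine ⟨fun y => Sum.elim (fun e => y (Sum.inl e)) fun s => [decide ((l, v) = s)], ?_, ?_⟩
    · rintro (e | s)
      · exact SafeOp.proj _
      · exact SafeOp.nil.cons _
    · intro S _ y hy
      funext j
      obtain e | s := j
      · exact hy e
      · simp [cfgWords]
  induction q generalizing v with
  | push k f q ih =>
    obtain ⟨Φ, h₀, h₁⟩ := ih (fun _ h => hq (Or.inr h)) v
    refine ⟨fun y => Φ (Sum.elim (fun e => if e.1.1 = k then decide (⟨k, f v⟩ = e.1) ::
      y (Sum.inl e) else y (Sum.inl e)) fun s => y (Sum.inr s)), fun j => (h₀ j).comp ?_, ?_⟩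
    · rintro (e | s)
      · by_cases h : e.1.1 = k
        · simp only [Sum.elim_inl, h, if_true]
          exact (SafeOp.proj _).cons _
        · simp only [Sum.elim_inl, h, if_false]
          exact SafeOp.proj _
      · exact SafeOp.proj _
    · intro S hS y hy
      refine h₁ _ (hS.push (hq (Or.inl ⟨v, rfl⟩))) _ fun e => ?_
      simp only [Sum.elim_inl, hy]
      rw [track_push]
  | peek k f q ih =>
    choose Φ h₀ h₁ using ih hq
    obtain ⟨Ψ, h₂, h₃⟩ := exists_safeOp_head? hA k (φ := fun o => Φ (f v o)) fun o => h₀ _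
    exact ⟨Ψ, h₂, fun S hS y hy => (h₃ S hS y hy).trans (h₁ _ S hS y hy)⟩
  | pop k f q ih =>
    choose Φ h₀ h₁ using ih hq
    let P : (A ⊕ (Option Λ × σ) → BWord) → A ⊕ (Option Λ × σ) → BWord := fun y =>
      Sum.elim (fun e => if e.1.1 = k then (y (Sum.inl e)).tail else y (Sum.inl e))
        fun s => y (Sum.inr s)
    have hP : ∀ j, SafeOp fun y => P y j := by
      rintro (e | s)
      · by_cases h : e.1.1 = k
        · simp only [P, Sum.elim_inl, h, if_true]
          exact (SafeOp.proj _).tail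
        · simp only [P, Sum.elim_inl, h, if_false]
          exact SafeOp.proj _
      · exact SafeOp.proj _
    obtain ⟨Ψ, h₂, h₃⟩ := exists_safeOp_head? hA k (φ := fun o y => Φ (f v o) (P y))
      fun o j => (h₀ (f v o) j).comp hP
    refine ⟨Ψ, h₂, fun S hS y hy => (h₃ S hS y hy).trans (h₁ _ _ (hS.pop k) _ fun e => ?_)⟩
    simp only [P, Sum.elim_inl, hy]
    rw [track_pop]
  | load a q ih => exact ih hq _
  | branch f q₁ q₂ h₁ h₂ =>
    simp only [TM2.stepAux]
    cases f v
    · exact h₂ (fun _ h => hq (Or.inr h)) v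
    · exact h₁ (fun _ h => hq (Or.inl h)) v
  | goto f => exact hgoto _ v
  | halt => exact hgoto none v

/-- A step of a machine is a safe operation on the words of a configuration. -/
theorem exists_safeOp_totalStep [Finite Λ] [Finite σ] {A : Set (Σ k, Γ k)} (hA : A.Finite)
    {M : Λ → TM2.Stmt Γ Λ σ} (hM : ∀ q, (M q).pushes ⊆ A) :
    ∃ Φ : (A ⊕ (Option Λ × σ) → BWord) → A ⊕ (Option Λ × σ) → BWord,
      (∀ j, SafeOp fun y => Φ y j) ∧
        ∀ c, Over A c.stk → Φ (cfgWords A c) = cfgWords A (totalStep M c) := by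
  choose Φ h₀ h₁ using fun q => exists_safeOp_stepAux hA (M q) (hM q)
  obtain ⟨Ψ, h₂, h₃, -⟩ := exists_safeOp_select (J := A ⊕ (Option Λ × σ)) Sum.inr
    (φ := fun s y => s.1.elim y fun q => Φ q s.2 y) (d := fun y => y)
    (by
      rintro ⟨_ | q, v⟩ j
      · exact SafeOp.proj j
      · exact h₀ q v j)
    SafeOp.proj
  refine ⟨Ψ, h₂, fun c hc => ?_⟩
  rw [h₃ (cfgWords A c) (c.l, c.var) fun s => by simp [cfgWords, eq_comm]]
  obtain ⟨_ | q, v, S⟩ := c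
  · rfl
  · exact h₁ q v S hc _ fun e => rfl

end TM2

/-! ### Simulation of polynomial-time machines -/

/-- A run that ends in the configuration `b` never meets the undefined step. -/
theorem totalStep_iterate {K Λ σ : Type} [DecidableEq K] {Γ : K → Type}
    {M : Λ → TM2.Stmt Γ Λ σ} {n : ℕ} {a b : TM2.Cfg Γ Λ σ}
    (h : (flip bind (TM2.step M))^[n] (some a) = some b) : (totalStep M)^[n] a = b := by
  induction n generalizing a with
  | zero => exact Option.some_inj.1 h
  | succ n ih =>
    rw [Function.iterate_succ_apply] at h ⊢
    change (flip bind (TM2.step M))^[n] (TM2.step M a) = some b at h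
    cases hs : TM2.step M a with
    | none =>
      rw [hs, Function.iterate_fixed rfl] at h
      cases h
    | some c =>
      rw [hs] at h
      rw [totalStep, hs]
      exact ih h

theorem length_encodeTuple {l : ℕ} (b : Fin l → BWord) :
    (encodeTuple b).length = ∑ j, (b j).length + l := by
  simp [encodeTuple, List.length_flatMap, List.map_ofFn, List.sum_ofFn, Finset.sum_add_distrib]

theorem exists_bwsc_map_encodeTuple {k l m : ℕ} (χ : Option Bool → Bool)
    {g : Fin m → (Fin k → BWord) → (Fin l → BWord) → BWord} (hg : ∀ j, Bwsc k l (g j))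
    (p : MvPolynomial (Fin k) ℕ) :
    ∃ G, Bwsc k l G ∧ ∀ x y, (∀ j, (g j x y).length ≤ polyLen p x) →
      G x y = (encodeTuple fun j => g j x y).map χ := by
  induction m with
  | zero => exact ⟨_, Bwsc.zero k l, fun x y _ => rfl⟩
  | succ m ih =>
    obtain ⟨G, hG, h⟩ := ih fun j => hg j.succ
    refine ⟨_, (hg 0).takeMapAppend (fun b => χ (some b)) p (hG.cons (χ none)), fun x y hb => ?_⟩
    rw [h x y fun j => hb j.succ, List.take_of_length_le (hb 0)]
    simp [encodeTuple, List.ofFn_succ, Function.comp_def]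

/-- The functions of the class that compute the words of the initial configuration. -/
theorem exists_bwsc_initList {k l : ℕ} (tm : FinTM2) (i : tm.Γ tm.k₀ ≃ Option Bool)
    (A : Set (Σ k, tm.Γ k)) (p : MvPolynomial (Fin k) ℕ) (j : A ⊕ (Option tm.Λ × tm.σ)) :
    ∃ G, Bwsc k l G ∧ ∀ x b, (∀ j, (b j).length ≤ polyLen p x) →
      G x b = cfgWords A (initList tm ((encodeTuple b).map i.invFun)) j := by
  classical
  obtain ⟨⟨k', s⟩, hs⟩ | s := j
  · by_cases h : k' = tm.k₀
    · subst h
      obtain ⟨G, hG, h⟩ := exists_bwsc_map_encodeTuple (fun a => decide (i.symm a = s))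
        (Bwsc.projSafe k l) p
      refine ⟨G, hG, fun x b hb => (h x b hb).trans ?_⟩
      simp [cfgWords, track, initList, Function.comp_def]
    · refine ⟨_, Bwsc.zero k l, fun x b _ => ?_⟩
      simp [cfgWords, track, initList, h]
  · refine ⟨_, (Bwsc.zero k l).cons (decide ((some tm.main, tm.initialState) = s)),
      fun x b _ => ?_⟩
    simp only [cfgWords, initList, Sum.elim_inr]
    congr

theorem length_initList_le (tm : FinTM2) (s : List (tm.Γ tm.k₀)) (k : tm.K) :
    ((initList tm s).stk k).length ≤ s.length := by
  by_cases h : k = tm.k₀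
  · subst h; simp [initList]
  · simp [initList, h]

theorem over_initList (tm : FinTM2) {A : Set (Σ k, tm.Γ k)}
    (hA : Set.range (Sigma.mk tm.k₀) ⊆ A) (s : List (tm.Γ tm.k₀)) :
    Over A (initList tm s).stk := by
  intro k a ha
  by_cases h : k = tm.k₀
  · subst h; exact hA ⟨a, rfl⟩
  · simp [initList, h] at ha

/-- The track of the letter `true` on the output stack is the output itself. -/
theorem track_haltList (tm : FinTM2) (o : tm.Γ tm.k₁ ≃ Bool) (w : BWord) :
    track (haltList tm (w.map o.invFun)).stk ⟨tm.k₁, o.symm true⟩ = w := by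
  simp [track, haltList, Function.comp_def]

theorem PolyTime.exists_bwsc {k l : ℕ} {f : (Fin l → BWord) → BWord} (hf : PolyTime f)
    (p : MvPolynomial (Fin k) ℕ) :
    ∃ F, Bwsc k l F ∧ ∀ x b, (∀ j, (b j).length ≤ polyLen p x) → F x b = f b := by
  obtain ⟨⟨⟨tm, i, o⟩, time, hout⟩⟩ := hf
  have := tm.ΛFin
  have := tm.σFin
  have : Finite (tm.Γ tm.k₀) := Finite.of_equiv _ i.symm
  let e₁ : Σ k, tm.Γ k := ⟨tm.k₁, o.symm true⟩
  -- The stacks may have infinite alphabets, but only finitely many symbols can ever occur.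
  let A : Set (Σ k, tm.Γ k) :=
    insert e₁ (Set.range (Sigma.mk tm.k₀) ∪ ⋃ q, (tm.m q).pushes)
  have hA : A.Finite :=
    ((Set.finite_range _).union (Set.finite_iUnion fun q => finite_pushes (tm.m q))).insert _
  have : Finite A := hA
  have hM : ∀ q, (tm.m q).pushes ⊆ A := fun q a ha =>
    Or.inr (Or.inr (Set.mem_iUnion.2 ⟨q, ha⟩))
  obtain ⟨Φ, hΦ, hstep⟩ := exists_safeOp_totalStep hA hM
  obtain ⟨D, hD⟩ := exists_length_totalStep_le tm.m
  choose G hG hinit using exists_bwsc_initList (k := k) (l := l) tm i A p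
  -- `n` bounds the length of the input, `t` the running time, `q` the length of the
  -- stacks; the summand `1` is for the words of the control states.
  let n : MvPolynomial (Fin k) ℕ := MvPolynomial.C l * p + MvPolynomial.C l
  let t : MvPolynomial (Fin k) ℕ := Polynomial.aeval n time
  let q : MvPolynomial (Fin k) ℕ := n + t * MvPolynomial.C D + 1
  obtain ⟨F, hF, h⟩ := exists_bwsc_iterate hΦ q t hG (Sum.inl ⟨e₁, Or.inl rfl⟩)
  refine ⟨F, hF, fun x b hb => ?_⟩
  let c : TM2.Cfg tm.Γ tm.Λ tm.σ := initList tm ((encodeTuple b).map i.invFun)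
  have hn : (encodeTuple b).length ≤ polyLen n x := by
    rw [length_encodeTuple]
    simpa [n, polyLen] using Finset.sum_le_card_nsmul Finset.univ _ _ fun j _ => hb j
  have ht : polyLen t x = time.eval (polyLen n x) := by
    simp only [t, polyLen]
    rw [Polynomial.aeval_def, Polynomial.hom_eval₂, ← Polynomial.eval₂_id]
    congr 1
    exact Subsingleton.elim _ _
  have hover : ∀ m, Over A ((totalStep tm.m)^[m] c).stk := by
    intro m
    induction m with
    | zero => exact over_initList tm (fun a ha => Or.inr (Or.inl ha)) _
    | succ m ih => rw [Function.iterate_succ_apply']; exact ih.totalStep hM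
  have hlen : ∀ m k, (((totalStep tm.m)^[m] c).stk k).length ≤ polyLen n x + m * D := by
    intro m k
    induction m with
    | zero => simpa using (length_initList_le tm _ k).trans (by simpa using hn)
    | succ m ih =>
      rw [Function.iterate_succ_apply']
      exact (hD _ k).trans (by rw [Nat.succ_mul]; omega)
  have hiter : ∀ m, Φ^[m] (fun j => G j x b) = cfgWords A ((totalStep tm.m)^[m] c) := by
    intro m
    induction m with
    | zero => funext j; exact hinit j x b hb
    | succ m ih =>
      rw [Function.iterate_succ_apply', ih, hstep _ (hover m), Function.iterate_succ_apply']
  have hq : polyLen q x = polyLen n x + polyLen t x * D + 1 := by simp [q, polyLen]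
  rw [h x b fun m hm j => ?_, hiter]
  · obtain ⟨⟨s, hs⟩, hle⟩ := hout b
    let c' : TM2.Cfg tm.Γ tm.Λ tm.σ := haltList tm ((f b).map o.invFun)
    have hs' : (totalStep tm.m)^[s] c = c' := totalStep_iterate hs
    have hc' : totalStep tm.m c' = c' := rfl
    have hst : s ≤ polyLen t x := by
      rw [ht]
      refine hle.trans ?_
      rw [Polynomial.eval_eq_sum_range, Polynomial.eval_eq_sum_range]
      gcongr
    obtain ⟨r, hr⟩ := Nat.exists_eq_add_of_le' hst
    rw [hr, Function.iterate_add_apply, hs', Function.iterate_fixed hc']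
    exact track_haltList tm o (f b)
  · rw [hiter, hq]
    obtain e | s := j
    · have := hlen m e.1.1
      have hmt := Nat.mul_le_mul_right D hm
      simp only [cfgWords, track, Sum.elim_inl, List.length_map]
      omega
    · simp [cfgWords]

end BWord

theorem mainTheorem3 (k l : ℕ) (f : (Fin l → BWord) → BWord) (hf : BWord.PolyTime f)
    (p : MvPolynomial (Fin k) ℕ) :
    ∃ F : (Fin k → BWord) → (Fin l → BWord) → BWord, BWord.Bwsc k l F ∧
      ∀ (x : Fin k → BWord) (b : Fin l → BWord),
        (∀ j, (b j).length ≤ MvPolynomial.eval (fun i => (x i).length) p) → F x b = f b :=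
  hf.exists_bwsc p
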